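/- For each $N\ge 1$ let $\Sigma_N=\{-1,1\}^N$ and let $H_N=(H_N(\sigma))_{\sigma\in\Sigma_N}$ be a Hamiltonian of the random energy model, that is, a centered Gaussian process with $\mathbb{E}\,H_N(\sigma)H_N(\tau)=N\delta_{\sigma,\tau}$ for all $\sigma,\tau\in\Sigma_N$; all the $H_N$ are defined on one probability space, with arbitrary joint law for different $N$. Let $$F_N(\beta)=\frac1N\log\sum_{\sigma\in\Sigma_N}\frac1{2^N}\exp\big(\beta H_N(\sigma)\big),\qquad \beta\in\mathbb{R}.$$ **Theorem (Parisi formula for the REM).** For every $\beta\in\mathbb{R}$, $F_N(\beta)$ converges almost surely, as $N\to\infty$, to a nonrandom limit $F(\beta)\in\mathbb{R}$, and $$F(\beta)=\inf_{0<m\le 1}\Big(\frac{\beta^2m}{2}+\frac{\log 2}{m}-\log 2\Big).$$ -/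

import Mathlib

open MeasureTheory ProbabilityTheory Filter Topology

/-- The configuration space `{-1, 1}^N` (the units of `ℤ` are exactly `-1` and `1`). -/
abbrev REMConfig (N : ℕ) : Type := Fin N → ℤˣ

/-- `H` is a Hamiltonian of the random energy model on `N` spins: a centered Gaussian process
indexed by `{-1, 1}^N` with `𝔼 H(σ) H(τ) = N δ_{σ,τ}`. -/
structure IsREMHamiltonian {Ω : Type*} [MeasurableSpace Ω] (P : Measure Ω) (N : ℕ)
    (H : REMConfig N → Ω → ℝ) : Prop where
  gaussian : IsGaussianProcess H P
  centered : ∀ σ, ∫ ω, H σ ω ∂P = 0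
  covariance : ∀ σ τ, ∫ ω, H σ ω * H τ ω ∂P = if σ = τ then (N : ℝ) else 0

/-- The free energy `F_N(β) = N⁻¹ log ∑_σ 2^{-N} exp (β H_N(σ))` of a realization `h` of the
Hamiltonian, i.e. with respect to the uniform probability measure on `{-1, 1}^N`. -/
noncomputable def remFreeEnergy (N : ℕ) (h : REMConfig N → ℝ) (β : ℝ) : ℝ :=
  1 / (N : ℝ) * Real.log (∑ σ : REMConfig N, 1 / (2 : ℝ) ^ N * Real.exp (β * h σ))

/-- `F` is the limiting free energy: for each inverse temperature `β`, the random variables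
`F_N(β)` converge almost surely to the nonrandom number `F β`. -/
def IsREMLimitingFreeEnergy {Ω : Type*} [MeasurableSpace Ω] (P : Measure Ω)
    (H : (N : ℕ) → REMConfig N → Ω → ℝ) (F : ℝ → ℝ) : Prop :=
  ∀ β : ℝ, ∀ᵐ ω ∂P,
    Tendsto (fun N : ℕ => remFreeEnergy N (fun σ => H N σ ω) β) atTop (𝓝 (F β))

/-!
Write `Z_N = ∑ σ, 2^{-N} exp (β H_N(σ))` and `φ(m) = β² m / 2 + log 2 / m - log 2`.

*Upper bound.* For `0 < m ≤ 1` the map `t ↦ t ^ m` is subadditive, so `Z_N ^ m` is at most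
`∑ σ, 2^{-Nm} exp (m β H_N(σ))`, whose expectation is exactly `exp (N m φ(m))`. Markov's inequality
gives `P (F_N ≥ x) ≤ exp (-N m (x - φ(m)))` (`IsREMHamiltonian.measureReal_le_remFreeEnergy_le`),
which is summable for `x > φ(m)`, and the Borel–Cantelli lemma yields `limsup F_N ≤ φ(m)` almost
surely.

*Lower bound.* Let `a² < 2 log 2`. A given energy lies in the window `[aN, aN + 1]` with probability
at least `p_N`, where `p_N` is of order `exp (-N a² / 2) / N` (`le_gaussianReal_real_Icc`). The
energies are pairwise independent, so Chebyshev's inequality shows that fewer than `2^N p_N / 2`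
energies fall into the window with probability at most `4 / (2^N p_N)`
(`measureReal_sum_indicator_lt_le`). This is summable, and keeping in `Z_N` only the
configurations in the window gives `liminf F_N ≥ β a - a² / 2` almost surely
(`ae_eventually_lt_remFreeEnergy`).

*Matching.* At `m = min 1 (√(2 log 2) / |β|)` one has `φ(m) = β a - a² / 2` with `a = m β`, and
`a² ≤ 2 log 2`; so the upper bound at this `m` is approached by the lower bounds at `t m β`, `t ↑ 1`
(`exists_sq_lt_and_lt_of_lt_parisi`).

Both Borel–Cantelli arguments use only the law of each `H_N` separately, so that the joint law for
different `N` plays no role.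
-/

/-! ### Gaussian marginals and pairwise independence of the energies -/

lemma IsREMHamiltonian.map_eq_gaussianReal {Ω : Type*} [MeasurableSpace Ω] {P : Measure Ω}
    {N : ℕ} {H : REMConfig N → Ω → ℝ} (hH : IsREMHamiltonian P N H) (σ : REMConfig N) :
    P.map (H σ) = gaussianReal 0 N := by
  have hσ := hH.gaussian.hasGaussianLaw_eval σ
  rw [hσ.map_eq_gaussianReal, variance_of_integral_eq_zero hσ.aemeasurable (hH.centered σ),
    hH.centered σ]
  have := hH.covariance σ σ
  simp only [if_true] at this
  simp only [pow_two, this, Real.toNNReal_natCast]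

lemma IsREMHamiltonian.indepFun {Ω : Type*} [MeasurableSpace Ω] {P : Measure Ω}
    {N : ℕ} {H : REMConfig N → Ω → ℝ} (hH : IsREMHamiltonian P N H)
    {σ τ : REMConfig N} (hne : σ ≠ τ) : IndepFun (H σ) (H τ) P := by
  have := hH.gaussian.isProbabilityMeasure
  refine hH.gaussian.hasGaussianLaw_prodMk.indepFun_of_covariance_eq_zero ?_
  rw [covariance_eq_sub (hH.gaussian.hasGaussianLaw_eval σ).memLp_two
    (hH.gaussian.hasGaussianLaw_eval τ).memLp_two, hH.centered σ]
  simpa [hne] using hH.covariance σ τ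

lemma card_REMConfig (N : ℕ) : Fintype.card (REMConfig N) = 2 ^ N := by simp

/-- The first Borel–Cantelli lemma with a real-valued summable bound. The sets need not be
measurable. -/
lemma ae_eventually_notMem_of_summable_measureReal {Ω : Type*} [MeasurableSpace Ω] {P : Measure Ω}
    [IsFiniteMeasure P] {s : ℕ → Set Ω} {u : ℕ → ℝ} (hu : Summable u)
    (h : ∀ᶠ n in atTop, P.real (s n) ≤ u n) : ∀ᵐ ω ∂P, ∀ᶠ n in atTop, ω ∉ s n := by
  refine ae_eventually_notMem ?_
  have hsum : Summable fun n ↦ P.real (s n) := by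
    refine hu.of_norm_bounded_eventually_nat ?_
    filter_upwards [h] with n hn
    rwa [Real.norm_of_nonneg measureReal_nonneg]
  have := hsum.tsum_ofReal_ne_top
  simpa using this

/-! ### Upper bound: fractional moments -/

lemma Real.rpow_sum_le_sum_rpow {ι : Type*} (s : Finset ι) {f : ι → ℝ} (hf : ∀ i, 0 ≤ f i)
    {m : ℝ} (hm0 : 0 < m) (hm1 : m ≤ 1) : (∑ i ∈ s, f i) ^ m ≤ ∑ i ∈ s, f i ^ m := by
  classical
  induction s using Finset.induction_on with
  | empty => simp [Real.zero_rpow hm0.ne']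
  | insert a s ha ih =>
    rw [Finset.sum_insert ha, Finset.sum_insert ha]
    exact (Real.rpow_add_le_add_rpow (hf a) (Finset.sum_nonneg fun i _ ↦ hf i) hm0.le hm1).trans
      (by gcongr)

/-- Upper tail of the free energy, from Markov's inequality for the `m`-th power of the partition
function. -/
lemma IsREMHamiltonian.measureReal_le_remFreeEnergy_le {Ω : Type*} [MeasurableSpace Ω]
    {P : Measure Ω} {N : ℕ} (hN : 1 ≤ N) {H : REMConfig N → Ω → ℝ}
    (hH : IsREMHamiltonian P N H) (β : ℝ) {m : ℝ} (hm0 : 0 < m) (hm1 : m ≤ 1) (x : ℝ) :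
    P.real {ω | x ≤ remFreeEnergy N (fun σ ↦ H σ ω) β} ≤
      Real.exp (N * -(m * (x - (β ^ 2 * m / 2 + Real.log 2 / m - Real.log 2)))) := by
  have := hH.gaussian.isProbabilityMeasure
  have hN' : (0 : ℝ) < N := by exact_mod_cast hN
  set g := β ^ 2 * m / 2 + Real.log 2 / m - Real.log 2 with hg
  -- `W` dominates the `m`-th power of the partition function.
  set W : Ω → ℝ := fun ω ↦ ∑ σ, (1 / (2 : ℝ) ^ N) ^ m * Real.exp (m * β * H σ ω) with hW
  have hint : ∀ σ, Integrable (fun ω ↦ Real.exp (m * β * H σ ω)) P := fun σ ↦ by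
    rw [← mgf_pos_iff, mgf_gaussianReal (hH.map_eq_gaussianReal σ)]
    exact Real.exp_pos _
  have hWint : Integrable W P := integrable_finsetSum _ fun σ _ ↦ (hint σ).const_mul _
  have hEW : ∫ ω, W ω ∂P = Real.exp (N * (m * g)) := by
    rw [hW, integral_finsetSum _ fun σ _ ↦ (hint σ).const_mul _]
    have h1 : ∀ σ, ∫ ω, (1 / (2 : ℝ) ^ N) ^ m * Real.exp (m * β * H σ ω) ∂P =
        (1 / (2 : ℝ) ^ N) ^ m * Real.exp (N * (m * β) ^ 2 / 2) := fun σ ↦ by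
      rw [integral_const_mul]
      have := mgf_gaussianReal (hH.map_eq_gaussianReal σ) (m * β)
      simp only [mgf, zero_mul, zero_add, NNReal.coe_natCast] at this
      rw [this]
    simp only [h1, Finset.sum_const, Finset.card_univ, card_REMConfig, nsmul_eq_mul]
    rw [Real.rpow_def_of_pos (by positivity), ← Real.exp_add, one_div, Real.log_inv, Real.log_pow]
    have h2 : ((2 ^ N : ℕ) : ℝ) = Real.exp (N * Real.log 2) := by
      rw [← Real.log_pow, Real.exp_log (by positivity)]; push_cast; rfl
    rw [h2, ← Real.exp_add, hg]
    congr 1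
    field_simp
    ring
  have hsub : {ω | x ≤ remFreeEnergy N (fun σ ↦ H σ ω) β} ⊆ {ω | Real.exp (N * (m * x)) ≤ W ω} := by
    intro ω hω
    simp only [Set.mem_ofPred_eq, remFreeEnergy] at hω ⊢
    set Z := ∑ σ, 1 / (2 : ℝ) ^ N * Real.exp (β * H σ ω) with hZ
    have hZpos : 0 < Z := Finset.sum_pos (fun _ _ ↦ by positivity) Finset.univ_nonempty
    have h1 : N * x ≤ Real.log Z := by
      rw [one_div, inv_mul_eq_div, le_div_iff₀ hN'] at hω
      linarith
    calc Real.exp (N * (m * x)) ≤ Real.exp (Real.log Z * m) := by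
          apply Real.exp_le_exp.2
          nlinarith
      _ = Z ^ m := (Real.rpow_def_of_pos hZpos m).symm
      _ ≤ ∑ σ, (1 / (2 : ℝ) ^ N * Real.exp (β * H σ ω)) ^ m :=
          Real.rpow_sum_le_sum_rpow _ (fun _ ↦ by positivity) hm0 hm1
      _ = W ω := by
          refine Finset.sum_congr rfl fun σ _ ↦ ?_
          rw [Real.mul_rpow (by positivity) (by positivity), ← Real.exp_mul]
          ring_nf
  have hmarkov := mul_meas_ge_le_integral_of_nonneg (μ := P)
    (ae_of_all _ fun ω ↦ Finset.sum_nonneg fun σ _ ↦ by positivity) hWint (Real.exp (N * (m * x)))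
  rw [hEW, ← le_div_iff₀' (Real.exp_pos _), ← Real.exp_sub] at hmarkov
  refine (measureReal_mono hsub).trans (hmarkov.trans_eq ?_)
  ring_nf

/-- Almost surely, `limsup F_N(β)` is at most the Parisi functional at any `m ∈ (0, 1]`. -/
lemma ae_eventually_remFreeEnergy_lt {Ω : Type*} [MeasurableSpace Ω] {P : Measure Ω}
    [IsProbabilityMeasure P] {H : (N : ℕ) → REMConfig N → Ω → ℝ}
    (hH : ∀ N : ℕ, 1 ≤ N → IsREMHamiltonian P N (H N)) (β : ℝ) {m : ℝ} (hm : m ∈ Set.Ioc (0 : ℝ) 1)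
    {x : ℝ} (hx : β ^ 2 * m / 2 + Real.log 2 / m - Real.log 2 < x) :
    ∀ᵐ ω ∂P, ∀ᶠ N in atTop, remFreeEnergy N (fun σ ↦ H N σ ω) β < x := by
  have hneg : -(m * (x - (β ^ 2 * m / 2 + Real.log 2 / m - Real.log 2))) < 0 :=
    neg_neg_of_pos (mul_pos hm.1 (sub_pos.2 hx))
  have := ae_eventually_notMem_of_summable_measureReal (P := P)
    (s := fun N ↦ {ω | x ≤ remFreeEnergy N (fun σ ↦ H N σ ω) β})
    (Real.summable_exp_nat_mul_iff.2 hneg) ?_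
  · simpa using this
  filter_upwards [eventually_ge_atTop 1] with N hN
  exact (hH N hN).measureReal_le_remFreeEnergy_le hN β hm.1 hm.2 x

/-! ### Lower bound: counting energies in a window -/

/-- Second moment method: if each of the pairwise independent `X i` lies in `S` with probability at
least `p`, it is unlikely that fewer than `card ι * p / 2` of them do. The variance of the count is at
most its mean, because the summands are indicators. -/
lemma measureReal_sum_indicator_lt_le {Ω ι : Type*} [MeasurableSpace Ω] [Fintype ι] [Nonempty ι]
    {P : Measure Ω} [IsProbabilityMeasure P] {X : ι → Ω → ℝ} (hX : ∀ i, AEMeasurable (X i) P)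
    (hind : Pairwise fun i j ↦ IndepFun (X i) (X j) P) {S : Set ℝ} (hS : MeasurableSet S)
    {p : ℝ} (hp : 0 < p) (hpS : ∀ i, p ≤ (P.map (X i)).real S) :
    P.real {ω | ∑ i, S.indicator 1 (X i ω) < Fintype.card ι * p / 2} ≤
      4 / (Fintype.card ι * p) := by
  have hφ : Measurable (S.indicator (1 : ℝ → ℝ)) := measurable_one.indicator hS
  set Y : ι → Ω → ℝ := fun i ↦ S.indicator 1 ∘ X i with hY
  have hYm : ∀ i, AEStronglyMeasurable (Y i) P := fun i ↦
    (hφ.comp_aemeasurable (hX i)).aestronglyMeasurable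
  have hY2 : ∀ i, MemLp (Y i) 2 P := fun i ↦ by
    refine MemLp.of_bound (hYm i) 1 (ae_of_all _ fun ω ↦ ?_)
    by_cases h : X i ω ∈ S <;> simp [hY, h]
  have hEY : ∀ i, ∫ ω, Y i ω ∂P = (P.map (X i)).real S := fun i ↦ by
    rw [hY]
    simp only [Function.comp_apply]
    rw [← integral_map (hX i) hφ.aestronglyMeasurable, integral_indicator_one hS]
  have hsq : ∀ i, Y i ^ 2 = Y i := fun i ↦ by
    ext ω
    by_cases h : X i ω ∈ S <;> simp [hY, h]
  set E : ℝ := ∑ i, (P.map (X i)).real S with hE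
  have hEp : Fintype.card ι * p ≤ E := by
    simpa using Finset.sum_le_sum (s := Finset.univ) fun i _ ↦ hpS i
  have hcard : 0 < (Fintype.card ι : ℝ) * p := mul_pos (by exact_mod_cast Fintype.card_pos) hp
  have hEpos : 0 < E := hcard.trans_le hEp
  have hEsum : ∫ ω, (∑ i, Y i) ω ∂P = E := by
    simp only [Finset.sum_apply]
    rw [integral_finsetSum _ fun i _ ↦ (hY2 i).integrable one_le_two]
    simp only [hEY, hE]
  have hvar : variance (∑ i, Y i) P ≤ E := by
    rw [IndepFun.variance_sum (fun i _ ↦ hY2 i) fun i _ j _ hij ↦ (hind hij).comp hφ hφ]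
    refine Finset.sum_le_sum fun i _ ↦ ?_
    refine (variance_le_expectation_sq (hYm i)).trans_eq ?_
    rw [hsq i, hEY]
  have hcheb := meas_ge_le_variance_div_sq (μ := P) (memLp_finsetSum' Finset.univ fun i _ ↦ hY2 i)
    (half_pos hEpos)
  rw [hEsum] at hcheb
  have hcheb' := ENNReal.toReal_le_of_le_ofReal
    (div_nonneg (variance_nonneg _ _) (sq_nonneg _)) hcheb
  refine (measureReal_mono ?_).trans (hcheb'.trans ?_)
  · intro ω hω
    simp only [Set.mem_ofPred_eq, Finset.sum_apply] at hω ⊢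
    have : ∑ i, Y i ω < E / 2 := hω.trans_le (by linarith)
    rw [abs_of_neg (by linarith)]
    linarith
  · calc variance (∑ i, Y i) P / (E / 2) ^ 2 ≤ E / (E / 2) ^ 2 := by gcongr
      _ = 4 / E := by field_simp; norm_num
      _ ≤ 4 / (Fintype.card ι * p) := by gcongr

/-- On `[aN, aN + 1]` the exponent `x² / (2N)` of the Gaussian density exceeds `N a² / 2` by at most
`|a| + 1`, and the normalization `√(2πN)` is at most `7 N`. -/
lemma le_gaussianReal_real_Icc {N : ℕ} (hN : 1 ≤ N) (a : ℝ) :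
    Real.exp (-|a| - 1) / 7 / N * Real.exp (N * -(a ^ 2 / 2)) ≤
      (gaussianReal 0 N).real (Set.Icc (a * N) (a * N + 1)) := by
  have hN' : (1 : ℝ) ≤ N := by exact_mod_cast hN
  have hN0 : (N : NNReal) ≠ 0 := by exact_mod_cast (by omega : N ≠ 0)
  set L := Real.exp (-|a| - 1) / 7 / N * Real.exp (N * -(a ^ 2 / 2)) with hL
  rw [measureReal_def, gaussianReal_apply_eq_integral _ hN0, ENNReal.toReal_ofReal
    (integral_nonneg fun x ↦ gaussianPDFReal_nonneg _ _ _)]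
  calc L = ∫ x in Set.Icc (a * N) (a * N + 1), L := by simp
    _ ≤ _ := by
      refine setIntegral_mono_on (by simp) (integrable_gaussianPDFReal _ _).integrableOn
        measurableSet_Icc fun x hx ↦ ?_
      rw [gaussianPDFReal, NNReal.coe_natCast]
      have h1 : √(2 * Real.pi * N) ≤ 7 * N := by
        rw [Real.sqrt_le_left (by positivity)]
        nlinarith [Real.pi_lt_four, Real.pi_pos]
      have h2 : -|a| - 1 + N * -(a ^ 2 / 2) ≤ -(x - 0) ^ 2 / (2 * N) := by
        obtain ⟨y, rfl⟩ : ∃ y, x = a * N + y := ⟨x - a * N, by ring⟩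
        have hy0 : 0 ≤ y := by linarith [hx.1]
        have hy1 : y ≤ 1 := by linarith [hx.2]
        rw [le_div_iff₀ (by positivity)]
        have h3 : a * y ≤ |a| := (mul_le_mul_of_nonneg_right (le_abs_self a) hy0).trans
          (mul_le_of_le_one_right (abs_nonneg a) hy1)
        nlinarith
      calc L = (7 * (N : ℝ))⁻¹ * Real.exp (-|a| - 1 + N * -(a ^ 2 / 2)) := by
            rw [hL, Real.exp_add]; field_simp
        _ ≤ _ := by gcongr

/-- Almost surely, `liminf F_N(β) ≥ β a - a² / 2` for every energy level `a` with
`a² < 2 log 2`, the range in which exponentially many energies are close to `a N`. -/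
lemma ae_eventually_lt_remFreeEnergy {Ω : Type*} [MeasurableSpace Ω] {P : Measure Ω}
    [IsProbabilityMeasure P] {H : (N : ℕ) → REMConfig N → Ω → ℝ}
    (hH : ∀ N : ℕ, 1 ≤ N → IsREMHamiltonian P N (H N)) (β : ℝ) {a : ℝ}
    (ha : a ^ 2 < 2 * Real.log 2) {x : ℝ} (hx : x < β * a - a ^ 2 / 2) :
    ∀ᵐ ω ∂P, ∀ᶠ N in atTop, x < remFreeEnergy N (fun σ ↦ H N σ ω) β := by
  set C := Real.exp (-|a| - 1) / 7 with hC
  have hCpos : 0 < C := by positivity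
  set p : ℕ → ℝ := fun N ↦ C / N * Real.exp (N * -(a ^ 2 / 2)) with hp
  set S : ℕ → Set ℝ := fun N ↦ Set.Icc (a * N) (a * N + 1) with hS
  have hsum : Summable fun N : ℕ ↦ 4 / (2 ^ N * p N) := by
    have h := (Real.summable_pow_mul_exp_neg_nat_mul 1
      (r := Real.log 2 - a ^ 2 / 2) (by linarith)).mul_left (4 / C)
    refine h.congr fun N ↦ ?_
    have h2 : (2 : ℝ) ^ N = Real.exp (N * Real.log 2) := by
      rw [← Real.log_pow, Real.exp_log (by positivity)]
    have h3 : -(Real.log 2 - a ^ 2 / 2) * N =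
        -(N * Real.log 2 + N * -(a ^ 2 / 2)) := by ring
    rcases eq_or_ne N 0 with rfl | hN
    · simp [hp]
    · rw [hp, h2, h3, Real.exp_neg, Real.exp_add]
      field_simp
  have hev := ae_eventually_notMem_of_summable_measureReal (P := P)
    (s := fun N ↦ {ω | ∑ σ, (S N).indicator 1 (H N σ ω) < 2 ^ N * p N / 2}) hsum ?_
  swap
  · filter_upwards [eventually_ge_atTop 1] with N hN
    have hN' : (0 : ℝ) < N := by exact_mod_cast hN
    have h := measureReal_sum_indicator_lt_le (P := P) (X := H N) (S := S N) (p := p N)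
      (fun σ ↦ (hH N hN).gaussian.aemeasurable σ) (fun σ τ hne ↦ (hH N hN).indepFun hne)
      measurableSet_Icc (by positivity) fun σ ↦ by
        rw [(hH N hN).map_eq_gaussianReal σ]
        exact le_gaussianReal_real_Icc hN a
    rw [card_REMConfig] at h
    push_cast at h
    exact h
  have hlim : Tendsto (fun N : ℕ ↦ β * a - a ^ 2 / 2 + (Real.log (C / 2) - |β|) / N
      - Real.log N / N) atTop (𝓝 (β * a - a ^ 2 / 2)) := by
    have h1 : Tendsto (fun N : ℕ ↦ Real.log N / N) atTop (𝓝 0) := by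
      exact (Real.isLittleO_log_id_atTop.tendsto_div_nhds_zero).comp
        tendsto_natCast_atTop_atTop
    have h2 := tendsto_const_div_atTop_nhds_zero_nat (Real.log (C / 2) - |β|)
    simpa using (h2.const_add (β * a - a ^ 2 / 2)).sub h1
  filter_upwards [hev] with ω hω
  filter_upwards [hω, eventually_ge_atTop 1, hlim.eventually_const_lt hx] with N hcount hN hxN
  have hN' : (0 : ℝ) < N := by exact_mod_cast hN
  refine hxN.trans_le ?_
  simp only [not_lt] at hcount
  -- In the window `β H` differs from `β a N` by at most `|β|`, whatever the sign of `β`.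
  have hterm : ∀ σ, (S N).indicator 1 (H N σ ω) * (1 / (2 : ℝ) ^ N * Real.exp (β * a * N - |β|)) ≤
      1 / (2 : ℝ) ^ N * Real.exp (β * H N σ ω) := fun σ ↦ by
    by_cases hσ : H N σ ω ∈ S N
    · rw [Set.indicator_of_mem hσ, Pi.one_apply, one_mul]
      gcongr
      have h0 : |H N σ ω - a * N| ≤ 1 := by
        rw [abs_of_nonneg (by linarith [hσ.1])]; linarith [hσ.2]
      have h1 : |β * (H N σ ω - a * N)| ≤ |β| := by
        rw [abs_mul]; exact mul_le_of_le_one_right (abs_nonneg β) h0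
      linarith [neg_abs_le (β * (H N σ ω - a * N))]
    · rw [Set.indicator_of_notMem hσ, zero_mul]
      positivity
  have hZ : C / 2 / N * Real.exp (N * (β * a - a ^ 2 / 2) - |β|) ≤
      ∑ σ, 1 / (2 : ℝ) ^ N * Real.exp (β * H N σ ω) := by
    refine le_trans ?_ (Finset.sum_le_sum fun σ _ ↦ hterm σ)
    rw [← Finset.sum_mul]
    refine le_trans (le_of_eq ?_) (mul_le_mul_of_nonneg_right hcount (by positivity))
    have : N * (β * a - a ^ 2 / 2) - |β| = N * -(a ^ 2 / 2) + (β * a * N - |β|) := by ring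
    rw [this, Real.exp_add, hp]
    field_simp
  have hlog := Real.log_le_log (by positivity) hZ
  rw [Real.log_mul (by positivity) (by positivity), Real.log_exp,
    Real.log_div (by positivity) hN'.ne'] at hlog
  rw [remFreeEnergy, one_div, inv_mul_eq_div, le_div_iff₀ hN']
  refine le_trans (le_of_eq ?_) hlog
  field_simp
  ring

/-! ### Matching the two bounds -/

/-- One half of the duality `inf_m (β² m / 2 + log 2 / m - log 2) = sup_a (β a - a² / 2)`, the
infimum being over `0 < m ≤ 1` and the supremum over `a² < 2 log 2`. -/
lemma exists_sq_lt_and_lt_of_lt_parisi {β x : ℝ}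
    (hx : ∀ m ∈ Set.Ioc (0 : ℝ) 1, x < β ^ 2 * m / 2 + Real.log 2 / m - Real.log 2) :
    ∃ a : ℝ, a ^ 2 < 2 * Real.log 2 ∧ x < β * a - a ^ 2 / 2 := by
  have hlog : 0 < Real.log 2 := Real.log_pos one_lt_two
  obtain ⟨m, hm, hmβ, hval⟩ : ∃ m ∈ Set.Ioc (0 : ℝ) 1, (m * β) ^ 2 ≤ 2 * Real.log 2 ∧
      β ^ 2 * m / 2 + Real.log 2 / m - Real.log 2 = β * (m * β) - (m * β) ^ 2 / 2 := by
    rcases le_total (β ^ 2) (2 * Real.log 2) with h | h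
    -- For `β² ≤ 2 log 2` (high temperature) the minimizer is `m = 1`.
    · exact ⟨1, by simp, by simpa using h, by ring⟩
    -- At low temperature it is `m = √(2 log 2) / |β|`.
    · have hβ : 0 < β ^ 2 := by linarith
      have hc : 0 < √(2 * Real.log 2 / β ^ 2) := Real.sqrt_pos.2 (by positivity)
      have hsq : √(2 * Real.log 2 / β ^ 2) ^ 2 = 2 * Real.log 2 / β ^ 2 :=
        Real.sq_sqrt (by positivity)
      have hsq' : (√(2 * Real.log 2 / β ^ 2) * β) ^ 2 = 2 * Real.log 2 := by
        rw [mul_pow, hsq, div_mul_cancel₀ _ hβ.ne']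
      refine ⟨√(2 * Real.log 2 / β ^ 2), ⟨hc, ?_⟩, hsq'.le, ?_⟩
      · exact Real.sqrt_le_one.2 ((div_le_one hβ).2 h)
      · have hl : Real.log 2 = (√(2 * Real.log 2 / β ^ 2) * β) ^ 2 / 2 := by rw [hsq']; ring
        generalize √(2 * Real.log 2 / β ^ 2) = m at *
        rw [hl]
        field_simp
        ring
  -- `a = m β` may lie on the boundary `a² = 2 log 2`, hence the perturbation `a = t m β` with `t < 1`.
  have hcont : Tendsto (fun t : ℝ ↦ β * (t * (m * β)) - (t * (m * β)) ^ 2 / 2) (𝓝[<] 1)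
      (𝓝 (β * (m * β) - (m * β) ^ 2 / 2)) := by
    have : Continuous fun t : ℝ ↦ β * (t * (m * β)) - (t * (m * β)) ^ 2 / 2 := by fun_prop
    simpa using (this.tendsto 1).mono_left nhdsWithin_le_nhds
  have hev := hcont.eventually_const_lt (hval ▸ hx m hm)
  obtain ⟨t, ht, ht0, ht1⟩ := (hev.and (Ioo_mem_nhdsLT (zero_lt_one (α := ℝ)))).exists
  refine ⟨t * (m * β), ?_, ht⟩
  rw [mul_pow]
  have : t ^ 2 < 1 := by nlinarith
  rcases (sq_nonneg (m * β)).eq_or_lt with h0 | h0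
  · rw [← h0]; linarith
  · exact (mul_lt_of_lt_one_left h0 this).trans_le hmβ

theorem mainTheorem7 {Ω : Type*} [MeasurableSpace Ω] (P : Measure Ω) [IsProbabilityMeasure P]
    (H : (N : ℕ) → REMConfig N → Ω → ℝ)
    (hH : ∀ N : ℕ, 1 ≤ N → IsREMHamiltonian P N (H N)) :
    ∃ F : ℝ → ℝ, IsREMLimitingFreeEnergy P H F ∧
      ∀ β : ℝ, IsGLB
        ((fun m : ℝ => β ^ 2 * m / 2 + Real.log 2 / m - Real.log 2) '' Set.Ioc (0 : ℝ) 1)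
        (F β) := by
  have hglb : ∀ β : ℝ, ∃ y, IsGLB
      ((fun m : ℝ => β ^ 2 * m / 2 + Real.log 2 / m - Real.log 2) '' Set.Ioc (0 : ℝ) 1) y := by
    refine fun β ↦ Real.exists_isGLB ((Set.nonempty_Ioc.2 one_pos).image _) ⟨0, ?_⟩
    rintro _ ⟨m, hm, rfl⟩
    have h1 : Real.log 2 ≤ Real.log 2 / m :=
      le_div_self (Real.log_pos one_lt_two).le hm.1 hm.2
    have h2 : 0 ≤ β ^ 2 * m / 2 := by have := hm.1; positivity
    simp only
    linarith
  choose F hF using hglb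
  refine ⟨F, fun β ↦ ?_, hF⟩
  -- It suffices to test convergence against countably many bounds `F β ± 1 / (k + 1)`.
  have hup : ∀ k : ℕ, ∀ᵐ ω ∂P, ∀ᶠ N in atTop,
      remFreeEnergy N (fun σ ↦ H N σ ω) β < F β + 1 / ((k : ℝ) + 1) := fun k ↦ by
    obtain ⟨_, ⟨m, hm, rfl⟩, -, hlt⟩ := (hF β).exists_between
      (lt_add_of_pos_right (F β) (Nat.one_div_pos_of_nat (n := k)))
    exact ae_eventually_remFreeEnergy_lt hH β hm hlt
  have hlow : ∀ k : ℕ, ∀ᵐ ω ∂P, ∀ᶠ N in atTop,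
      F β - 1 / ((k : ℝ) + 1) < remFreeEnergy N (fun σ ↦ H N σ ω) β := fun k ↦ by
    obtain ⟨a, ha, hlt⟩ := exists_sq_lt_and_lt_of_lt_parisi (β := β)
      (x := F β - 1 / ((k : ℝ) + 1)) fun m hm ↦
        (sub_lt_self _ Nat.one_div_pos_of_nat).trans_le ((hF β).1 (Set.mem_image_of_mem _ hm))
    exact ae_eventually_lt_remFreeEnergy hH β ha hlt
  filter_upwards [ae_all_iff.2 hup, ae_all_iff.2 hlow] with ω hωu hωl
  rw [Metric.tendsto_nhds]
  intro ε hε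
  obtain ⟨k, hk⟩ := exists_nat_one_div_lt hε
  filter_upwards [hωu k, hωl k] with N h1 h2
  rw [Real.dist_eq, abs_lt]
  constructor <;> linarith
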